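/- Let $m\ge 1$ and let $\mathbb{R}_m$ be the real Clifford algebra generated by $e_1,\dots,e_m$ with $e_j^2=-1$ and $e_ie_j=-e_je_i$ ($i\ne j$), with norm $|\lambda|^2=\sum_A\lambda_A^2$ for $\lambda=\sum_{A}\lambda_Ae_A$. Identify $x\in\mathbb{R}^m$ with $\sum_j x_je_j\in\mathbb{R}_m$, so that $x^2=-|x|^2$, and let $\partial_x=\sum_j e_j\partial_{x_j}$ be the Dirac operator. Let $k\ge 0$ and let $Y_k$ be a left solid inner spherical monogenic of order $k$, i.e. an $\mathbb{R}_m$-valued homogeneous polynomial of degree $k$ on $\mathbb{R}^m$ with $\partial_xY_k=0$. For $\alpha>-1$ put $D_\alpha f=(1+x^2)^{-\alpha}\partial_x\big((1+x^2)^{\alpha+1}f\big)$. The Clifford-Legendre polynomials are $C^0_{n,m}(Y_k)=D_0D_1\cdots D_{n-1}Y_k$ $(n\ge 0)$, and the normalized Clifford-Legendre polynomials are $$\overline{C}^{\,0}_{n,m}(Y_k)=\frac{\sqrt{2k+2n+m}}{2^n\,n!}\,C^0_{n,m}(Y_k).$$ If $\int_{S^{m-1}}|Y_k(\theta)|^2\,d\theta=1$,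 these have norm one in $L^2(B(1),\mathbb{R}_m)$, where $B(1)$ is the closed unit ball: $\int_{B(1)}|\overline{C}^{\,0}_{n,m}(Y_k)(x)|^2\,dx=1$ for all $n\ge 0$. Moreover, for all $N\ge 0$ and all $x\in\mathbb{R}^m$ the following Bonnet type formulas hold. (a) (Even index.) $$x\,\overline{C}^{\,0}_{2N,m}(Y_k)(x)=A_{N,k,m}\,\overline{C}^{\,0}_{2N+1,m}(Y_k)(x)+B_{N,k,m}\,\overline{C}^{\,0}_{2N-1,m}(Y_k)(x),$$ where $$A_{N,k,m}=\frac{-(\frac m2+N+k)\sqrt{m+4N+2k}}{(\frac m2+2N+k)\sqrt{m+4N+2k+2}},\qquad B_{N,k,m}=\frac{N\sqrt{m+4N+2k}}{(\frac m2+2N+k)\sqrt{m+4N+2k-2}},$$ and for $N=0$ the second term is absent. (b) (Odd index.) $$x\,\overline{C}^{\,0}_{2N+1,m}(Y_k)(x)=A'_{N,k,m}\,\overline{C}^{\,0}_{2N+2,m}(Y_k)(x)+B'_{N,k,m}\,\overline{C}^{\,0}_{2N,m}(Y_k)(x),$$ where $$A'_{N,k,m}=\frac{-(N+1)\sqrt{m+4N+2k+2}}{(\frac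 m2+2N+k+1)\sqrt{m+4N+2k+4}},\qquad B'_{N,k,m}=\frac{(\frac m2+N+k)\sqrt{m+4N+2k+2}}{(\frac m2+2N+k+1)\sqrt{m+4N+2k}}.$$ -/

import Mathlib

open MeasureTheory

noncomputable section

namespace CliffordLegendre

/-- Euclidean space `ℝ^m`. -/
abbrev E (m : ℕ) : Type := EuclideanSpace ℝ (Fin m)

/-- The quadratic form `x ↦ -|x|²` on `ℝ^m`. -/
def negNormSq (m : ℕ) : QuadraticForm ℝ (E m) :=
  -(LinearMap.BilinMap.toQuadraticMap (innerₗ (E m)))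

theorem negNormSq_apply (m : ℕ) (x : E m) : negNormSq m x = -‖x‖ ^ 2 := by
  simp [negNormSq]

/-- The real Clifford algebra `ℝ_m`: vectors `x ∈ ℝ^m` satisfy `x² = -|x|²`. -/
abbrev Cl (m : ℕ) : Type := CliffordAlgebra (negNormSq m)

/-- The standard identification of a point `x ∈ ℝ^m` with the Clifford vector `∑ⱼ xⱼ eⱼ`. -/
def vec {m : ℕ} (x : E m) : Cl m := CliffordAlgebra.ι (negNormSq m) x

/-- The standard basis vectors of `ℝ^m`. -/
def stdVec {m : ℕ} (j : Fin m) : E m := EuclideanSpace.single j 1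

/-- The generators `eⱼ` of `ℝ_m`. -/
def e {m : ℕ} (j : Fin m) : Cl m := vec (stdVec j)

theorem vec_mul_self {m : ℕ} (x : E m) : vec x * vec x = algebraMap ℝ (Cl m) (-‖x‖ ^ 2) := by
  rw [vec, CliffordAlgebra.ι_sq_scalar, negNormSq_apply]

theorem e_mul_self {m : ℕ} (j : Fin m) : e j * e j = -1 := by
  rw [e, vec_mul_self]; simp [stdVec]

theorem e_mul_e {m : ℕ} {i j : Fin m} (h : i ≠ j) : e i * e j = -(e j * e i) := by
  have := CliffordAlgebra.ι_mul_ι_add_swap (Q := negNormSq m) (stdVec i) (stdVec j)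
  have h0 : QuadraticMap.polar (negNormSq m) (stdVec i) (stdVec j) = 0 := by
    simp [QuadraticMap.polar, negNormSq, stdVec, inner_add_right,
      EuclideanSpace.inner_single_left, h, h.symm]
  rw [e, e, vec, vec, eq_neg_iff_add_eq_zero, this, h0, map_zero]

/-- The basis `e_A`, `A ⊆ {1, …, m}`, of `ℝ_m`; see `bladeBasis_apply`. -/
def bladeBasis (m : ℕ) : Module.Basis (Finset (Fin m)) ℝ (Cl m) :=
  ((EuclideanSpace.basisFun (Fin m) ℝ).toBasis.ExteriorAlgebra).map
    (CliffordAlgebra.equivExterior (negNormSq m)).symm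

theorem contractLeft_prod_eq_zero {m : ℕ} (Q : QuadraticForm ℝ (E m)) (d : Module.Dual ℝ (E m))
    (l : List (Fin m)) (hl : ∀ j ∈ l, d (stdVec j) = 0) :
    CliffordAlgebra.contractLeft d
      (l.map fun j => CliffordAlgebra.ι Q (stdVec j)).prod = 0 := by
  induction l with
  | nil => simp
  | cons a l ih =>
    rw [List.map_cons, List.prod_cons, CliffordAlgebra.contractLeft_ι_mul,
      ih fun j hj => hl j (List.mem_cons_of_mem _ hj), hl a List.mem_cons_self]
    simp

theorem equivExterior_prod {m : ℕ} (l : List (Fin m)) (hl : l.Nodup) :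
    CliffordAlgebra.equivExterior (negNormSq m) (l.map e).prod =
      (l.map fun j => ExteriorAlgebra.ι ℝ (stdVec j : E m)).prod := by
  induction l with
  | nil => simp [CliffordAlgebra.changeFormEquiv]
  | cons a l ih =>
    have h := ih hl.of_cons
    simp only [CliffordAlgebra.equivExterior, CliffordAlgebra.changeFormEquiv_apply] at h ⊢
    rw [List.map_cons, List.prod_cons, e, vec, CliffordAlgebra.changeForm_ι_mul, h,
      contractLeft_prod_eq_zero, sub_zero]
    · rfl
    · intro j hj
      have hne : a ≠ j := fun hh => (List.nodup_cons.1 hl).1 (hh ▸ hj)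
      simp [QuadraticMap.associated_apply, negNormSq, stdVec, inner_add_right,
        EuclideanSpace.inner_single_left, hne, hne.symm]

/-- `e_A = e_{j₁} ⋯ e_{jₕ}` for `A = {j₁ < ⋯ < jₕ}`. -/
theorem bladeBasis_apply {m : ℕ} (A : Finset (Fin m)) :
    bladeBasis m A = ((A.sort (· ≤ ·)).map e).prod := by
  rw [bladeBasis, Module.Basis.map_apply, LinearEquiv.symm_apply_eq,
    equivExterior_prod _ (Finset.sort_nodup _ _),
    ExteriorAlgebra.basis_apply_ofCard _ (rfl : A.card = A.card)]
  rw [ExteriorAlgebra.ιMulti_family, ExteriorAlgebra.ιMulti_apply]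
  congr 1
  refine List.ext_getElem (by simp) fun i h1 h2 => ?_
  simp [stdVec, Set.powersetCard.ofFinEmbEquiv_symm_apply, Finset.orderEmbOfFin_apply]

/-- The coordinates `(λ_A)_A` of a Clifford number `λ = ∑_A λ_A e_A`. -/
def coords (m : ℕ) : Cl m →ₗ[ℝ] EuclideanSpace ℝ (Finset (Fin m)) :=
  (WithLp.linearEquiv 2 ℝ (Finset (Fin m) → ℝ)).symm.toLinearMap ∘ₗ
    (bladeBasis m).equivFun.toLinearMap

theorem coords_injective (m : ℕ) : Function.Injective (coords m) :=
  (WithLp.linearEquiv 2 ℝ (Finset (Fin m) → ℝ)).symm.injective.comp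
    (bladeBasis m).equivFun.injective

/-- The Clifford norm `|λ|² = ∑_A λ_A²`; see `norm_sq_eq`. -/
instance instNormedAddCommGroupCl (m : ℕ) : NormedAddCommGroup (Cl m) :=
  NormedAddCommGroup.induced (Cl m) (EuclideanSpace ℝ (Finset (Fin m))) (coords m)
    (coords_injective m)

instance instNormedSpaceCl (m : ℕ) : NormedSpace ℝ (Cl m) :=
  NormedSpace.induced ℝ (Cl m) (EuclideanSpace ℝ (Finset (Fin m))) (coords m)

theorem norm_sq_eq {m : ℕ} (c : Cl m) : ‖c‖ ^ 2 = ∑ A, ((bladeBasis m).repr c A) ^ 2 := by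
  have : ‖c‖ = ‖coords m c‖ := rfl
  rw [this, EuclideanSpace.norm_sq_eq]
  simp [coords]

/-- The Dirac operator `∂ₓ f = ∑ⱼ eⱼ ∂f/∂xⱼ`. -/
def dirac {m : ℕ} (f : E m → Cl m) : E m → Cl m := fun x =>
  ∑ j, e j * lineDeriv ℝ f x (stdVec j)

/-- `Y` is a Clifford-algebra-valued polynomial on `ℝ^m`, homogeneous of degree `k`. -/
def IsHomogeneousPolynomial {m : ℕ} (k : ℕ) (Y : E m → Cl m) : Prop :=
  ∃ p : Finset (Fin m) → MvPolynomial (Fin m) ℝ, (∀ A, (p A).IsHomogeneous k) ∧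
    ∀ x : E m, Y x = ∑ A, MvPolynomial.eval (fun j => x j) (p A) • bladeBasis m A

/-- The left solid inner spherical monogenics of order `k` on `ℝ^m`: the left monogenic
homogeneous polynomials of degree `k`. -/
def sphericalMonogenics (m k : ℕ) : Set (E m → Cl m) :=
  {Y | IsHomogeneousPolynomial k Y ∧ ∀ x, dirac Y x = 0}

/-- The operator `D_α f = (1 + x²)^{-α} ∂ₓ((1 + x²)^{α+1} f)`, where `1 + x² = 1 - |x|²`. -/
def diffOp {m : ℕ} (α : ℝ) (f : E m → Cl m) : E m → Cl m := fun x =>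
  (1 - ‖x‖ ^ 2) ^ (-α) • dirac (fun y => (1 - ‖y‖ ^ 2) ^ (α + 1) • f y) x

/-- The Clifford-Gegenbauer polynomial `C_{n,m}^α(Y) = D_α D_{α+1} ⋯ D_{α+n-1} Y`. -/
def gegenbauer {m : ℕ} : ℝ → ℕ → (E m → Cl m) → E m → Cl m
  | _, 0, Y => Y
  | α, n + 1, Y => diffOp α (gegenbauer (α + 1) n Y)

/-- The Clifford-Legendre polynomial `C_{n,m}^0(Y)`. -/
def legendre {m : ℕ} (n : ℕ) (Y : E m → Cl m) : E m → Cl m := gegenbauer 0 n Y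

/-- The normalised Clifford-Legendre polynomial
`√(2k + 2n + m) / (2ⁿ n!) · C_{n,m}^0(Y)`, for `Y` of degree `k`. -/
def normalizedLegendre {m : ℕ} (k n : ℕ) (Y : E m → Cl m) : E m → Cl m := fun x =>
  (Real.sqrt (2 * k + 2 * n + m) / (2 ^ n * (n.factorial : ℝ))) • legendre n Y x

end CliffordLegendre

end

noncomputable section

namespace CliffordLegendre

open Polynomial

/-! Everything reduces to real polynomials in one variable. On products `P(x) Y` with `Y` monogenic
of degree `k`, the Dirac operator acts on `P` alone: it sends `x^s` to `-γ_s x^(s-1)`, with `γ_s`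
depending only on `s` and `c = 2k + m`. Since `1 + x²` is a scalar, the operators `D_α` telescope
into a Rodrigues formula, `C_n^0(Y) = ∂ⁿ((1 + x²)ⁿ Y)` (`weight_smul_gegenbauer`). The coefficients
of the one-variable polynomial are thus products of consecutive `γ`'s times a binomial coefficient,
and comparing them gives the three-term recurrence `X_mul_scaledLegendre`, for both parities at
once. The square-root normalization makes the matrix of multiplication by `X` skew-symmetric.

The norm is then obtained without integrating squares. Left multiplication by `x` is skew for the
Clifford inner product and `x² = -|x|²`, so `|P(x) a|²` is `Re (P(-ir) P(ir)) |a|²` with `r = |x|`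
(`norm_sq_aeval_mul`). Polar coordinates split the ball integral into the sphere integral of `|Y|²`
and the form `radialForm` with weight `r^(c-1)`. For this form multiplication by `X` is skew, and
the constant polynomial is orthogonal to all later ones because each of those is a derivative of
something vanishing on the sphere (`moment_scaledLegendre`). Together with the recurrence this
forces orthonormality, as in Favard's theorem (`radialForm_orthoLegendre`). -/

/-! ### The one-variable model of the Dirac operator -/

/-- The numbers `γ_s` with `∂ₓ(x^s Y) = -γ_s x^{s-1} Y` for `Y` monogenic of degree `k`,
where `c = 2k + m`. -/
def diracCoeff (c : ℝ) : ℕ → ℝ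
  | 0 => 0
  | s + 1 => c + 2 * s - diracCoeff c s

theorem diracCoeff_two_mul (c : ℝ) (j : ℕ) :
    diracCoeff c (2 * j) = 2 * j ∧ diracCoeff c (2 * j + 1) = c + 2 * j := by
  induction j with
  | zero => simp [diracCoeff]
  | succ j ih =>
    have h : diracCoeff c (2 * (j + 1)) = 2 * ((j + 1 : ℕ) : ℝ) := by
      rw [show 2 * (j + 1) = 2 * j + 1 + 1 by ring, diracCoeff, ih.2]; push_cast; ring
    refine ⟨h, ?_⟩
    rw [diracCoeff, h]; push_cast; ring

theorem diracCoeff_even (c : ℝ) (j : ℕ) : diracCoeff c (2 * j) = 2 * j :=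
  (diracCoeff_two_mul c j).1

theorem diracCoeff_odd (c : ℝ) (j : ℕ) : diracCoeff c (2 * j + 1) = c + 2 * j :=
  (diracCoeff_two_mul c j).2

theorem diracCoeff_add_two (c : ℝ) (s : ℕ) : diracCoeff c (s + 2) = diracCoeff c s + 2 := by
  rw [diracCoeff, diracCoeff]; push_cast; ring

/-- The action of the Dirac operator on `P` in `P(x) Y`, with `Y` monogenic of degree `k` and
`c = 2k + m`. -/
def radialDirac (c : ℝ) : ℝ[X] →ₗ[ℝ] ℝ[X] :=
  Polynomial.lsum fun s => -(diracCoeff c s) • Polynomial.monomial (s - 1)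

theorem radialDirac_monomial (c : ℝ) (s : ℕ) (r : ℝ) :
    radialDirac c (monomial s r) = -(diracCoeff c s) • monomial (s - 1) r := by
  simp [radialDirac, Polynomial.lsum_apply, Polynomial.sum_monomial_index]

theorem coeff_radialDirac (c : ℝ) (P : ℝ[X]) (s : ℕ) :
    (radialDirac c P).coeff s = -(diracCoeff c (s + 1)) * P.coeff (s + 1) := by
  induction P using Polynomial.induction_on' with
  | add p q hp hq => rw [map_add, coeff_add, hp, hq, coeff_add]; ring
  | monomial n r =>
    rw [radialDirac_monomial, coeff_smul, coeff_monomial, coeff_monomial, smul_eq_mul]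
    rcases n with _ | n
    · simp [diracCoeff]
    · by_cases h : n = s <;> simp [h]

/-- The polynomial `1 + X²`. -/
def weight : ℝ[X] := X ^ 2 + 1

/-- The Leibniz rule for the scalar factor `x²`, whose Dirac derivative is `-2x`; on monomials it is
`γ_(s+2) = γ_s + 2`. -/
theorem radialDirac_sq_mul (c : ℝ) (P : ℝ[X]) :
    radialDirac c (X ^ 2 * P) = X ^ 2 * radialDirac c P - 2 * X * P := by
  induction P using Polynomial.induction_on' with
  | add p q hp hq => rw [mul_add, map_add, hp, hq, map_add]; ring
  | monomial n r =>
    rw [X_pow_mul_monomial, radialDirac_monomial, radialDirac_monomial, diracCoeff_add_two,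
      mul_smul_comm, X_pow_mul_monomial, mul_assoc, X_mul_monomial]
    rcases n with _ | n
    · simp [diracCoeff, two_mul, ← two_smul ℝ]
    · rw [show n + 1 + 2 - 1 = n + 2 by omega, show n + 1 - 1 + 2 = n + 2 by omega,
        show n + 1 + 1 = n + 2 by omega, neg_add, add_smul, sub_eq_add_neg, neg_smul (2 : ℝ),
        two_smul, two_mul]

theorem radialDirac_weight_mul (c : ℝ) (P : ℝ[X]) :
    radialDirac c (weight * P) = weight * radialDirac c P - 2 * X * P := by
  rw [weight, add_mul, one_mul, map_add, radialDirac_sq_mul]; ring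

theorem radialDirac_weight_pow_mul (c : ℝ) (j : ℕ) (P : ℝ[X]) :
    radialDirac c (weight ^ (j + 1) * P) =
      weight ^ j * (weight * radialDirac c P - C (2 * (j + 1) : ℝ) * X * P) := by
  induction j with
  | zero =>
    rw [zero_add, pow_one, radialDirac_weight_mul]; simp [show (C 2 : ℝ[X]) = 2 from map_ofNat C 2]
  | succ j ih =>
    rw [pow_succ' weight (j + 1), mul_assoc, radialDirac_weight_mul, ih]
    simp only [Nat.cast_add, Nat.cast_one, C_mul, C_add, C_1, map_ofNat, map_natCast]; ring

theorem weight_pow_dvd_radialDirac (c : ℝ) (j : ℕ) {P : ℝ[X]} (h : weight ^ (j + 1) ∣ P) :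
    weight ^ j ∣ radialDirac c P := by
  obtain ⟨Q, rfl⟩ := h
  rw [radialDirac_weight_pow_mul]; exact dvd_mul_right _ _

/-- Each derivative costs one factor of the weight. The remaining factors give the vanishing on the
unit sphere needed for the moments, and settle the Rodrigues formula at points where `1 - |x|²` is
zero. -/
theorem weight_pow_dvd_iterate (c : ℝ) (n : ℕ) : ∀ j : ℕ,
    weight ^ j ∣ (radialDirac c)^[n] (weight ^ (j + n)) := by
  induction n with
  | zero => simp
  | succ n ih =>
    intro j
    rw [Function.iterate_succ_apply', show j + (n + 1) = j + 1 + n by ring]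
    exact weight_pow_dvd_radialDirac c j (ih (j + 1))

theorem coeff_iterate_radialDirac (c : ℝ) (n : ℕ) (P : ℝ[X]) : ∀ s : ℕ,
    ((radialDirac c)^[n] P).coeff s =
      (-1) ^ n * (∏ i ∈ Finset.range n, diracCoeff c (s + 1 + i)) * P.coeff (s + n) := by
  induction n with
  | zero => simp
  | succ n ih =>
    intro s
    rw [Function.iterate_succ_apply', coeff_radialDirac, ih, Finset.prod_range_succ',
      show s + 1 + n = s + (n + 1) by ring, pow_succ]
    have : ∀ i, s + 1 + 1 + i = s + 1 + (i + 1) := fun i => by ring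
    simp only [this, add_zero]; ring

theorem coeff_weight_pow_even (n j : ℕ) : (weight ^ n).coeff (2 * j) = n.choose j := by
  have : weight ^ n = Polynomial.expand ℝ 2 ((X + 1) ^ n) := by simp [weight]
  rw [this, mul_comm, Polynomial.coeff_expand_mul (by norm_num), Polynomial.coeff_X_add_one_pow]

theorem coeff_weight_pow_odd (n s : ℕ) (h : Odd s) : (weight ^ n).coeff s = 0 := by
  have : weight ^ n = Polynomial.expand ℝ 2 ((X + 1) ^ n) := by simp [weight]
  rw [this, Polynomial.coeff_expand (by norm_num), if_neg]
  rwa [← even_iff_two_dvd, Nat.not_even_iff_odd]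

/-! ### The three-term recurrence -/

/-- The polynomial `R_n` with `C_{n,m}^0(Y) = 2ⁿ n! R_n(x) Y` (where `c = 2k + m`). -/
def scaledLegendre (c : ℝ) (n : ℕ) : ℝ[X] :=
  (2 ^ n * (n.factorial : ℝ))⁻¹ • (radialDirac c)^[n] (weight ^ n)

/-- The numerators in the Bonnet formulas. -/
def bonnetCoeff (c : ℝ) (n : ℕ) : ℝ := if Even n then c + n else n + 1

theorem coeff_scaledLegendre (c : ℝ) (n s : ℕ) :
    (scaledLegendre c n).coeff s = (2 ^ n * (n.factorial : ℝ))⁻¹ *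
      ((-1) ^ n * (∏ i ∈ Finset.range n, diracCoeff c (s + 1 + i)) *
        (weight ^ n).coeff (s + n)) := by
  rw [scaledLegendre, coeff_smul, coeff_iterate_radialDirac, smul_eq_mul]

/-- Multiplication by `X` shifts the product of `γ`'s down by one index. Splitting off its lowest
factor `γ_s` makes the formula valid at `s = 0` too, since `γ_0 = 0`, and leaves the same product
over `range n` that occurs in the coefficients of `R_n` and `R_(n+2)`. -/
theorem coeff_X_mul_scaledLegendre (c : ℝ) (n s : ℕ) :
    (X * scaledLegendre c (n + 1)).coeff s = (2 ^ (n + 1) * ((n + 1).factorial : ℝ))⁻¹ *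
      ((-1) ^ (n + 1) * (diracCoeff c s * ∏ i ∈ Finset.range n, diracCoeff c (s + 1 + i)) *
        (weight ^ (n + 1)).coeff (s + n)) := by
  rcases s with _ | s
  · simp [diracCoeff]
  · rw [coeff_X_mul, coeff_scaledLegendre, Finset.prod_range_succ',
      show s + 1 + n = s + (n + 1) by ring]
    have : ∀ i, s + 1 + 1 + i = s + 1 + (i + 1) := fun i => by ring
    simp only [this, add_zero]; ring

/-- What remains of the recurrence, coefficient by coefficient, once common factors are cancelled.
The numbers `bonnetCoeff c n` are in fact `γ_(n+1)`. -/
theorem bonnet_diracCoeff (c : ℝ) (n s j : ℕ) (h : s + n = 2 * j) :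
    (c + 2 * n + 2) * diracCoeff c s =
      bonnetCoeff c (n + 1) * (c + 2 * j) - bonnetCoeff c n * (2 * (n + 1 - j)) := by
  have h' : (s : ℝ) = 2 * j - n := by rw [eq_sub_iff_add_eq]; exact_mod_cast h
  rcases Nat.even_or_odd' n with ⟨N, rfl | rfl⟩
  · obtain ⟨i, rfl⟩ : ∃ i, s = 2 * i := ⟨j - N, by omega⟩
    have e1 : ¬ Even (2 * N + 1) := by simp
    rw [diracCoeff_even, bonnetCoeff, bonnetCoeff, if_neg e1, if_pos (by simp)]
    push_cast at *
    have hi : (i : ℝ) = j - N := by linarith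
    rw [hi]; ring
  · obtain ⟨i, rfl⟩ : ∃ i, s = 2 * i + 1 := ⟨j - N - 1, by omega⟩
    have e1 : ¬ Even (2 * N + 1) := by simp
    rw [diracCoeff_odd, bonnetCoeff, bonnetCoeff, if_neg e1,
      if_pos (by rw [Nat.even_add_one]; exact e1)]
    push_cast at *
    have hi : (i : ℝ) = j - N - 1 := by linarith
    rw [hi]; ring

/-- The three-term recurrence. -/
theorem X_mul_scaledLegendre (c : ℝ) (n : ℕ) :
    (c + 2 * n + 2) • (X * scaledLegendre c (n + 1)) =
      -(bonnetCoeff c (n + 1)) • scaledLegendre c (n + 2) +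
        bonnetCoeff c n • scaledLegendre c n := by
  ext s
  rw [coeff_smul, coeff_add, coeff_smul, coeff_smul, coeff_X_mul_scaledLegendre,
    coeff_scaledLegendre, coeff_scaledLegendre]
  simp only [smul_eq_mul]
  rcases Nat.even_or_odd' (s + n) with ⟨j, hj | hj⟩
  · have hb := bonnet_diracCoeff c n s j hj
    rw [show s + (n + 2) = 2 * (j + 1) by omega, hj, coeff_weight_pow_even,
      coeff_weight_pow_even, coeff_weight_pow_even, Finset.prod_range_succ,
      Finset.prod_range_succ, show s + 1 + n = 2 * j + 1 by omega,
      show s + 1 + (n + 1) = 2 * (j + 1) by omega, diracCoeff_odd, diracCoeff_even]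
    -- These two absorption identities express all three binomial coefficients through `(n +
    -- 1).choose j`.
    have h1 : ((n + 1 + 1 : ℕ) : ℝ) * (n + 1).choose j = (n + 2).choose (j + 1) * (j + 1 : ℕ) := by
      exact_mod_cast Nat.add_one_mul_choose_eq (n + 1) j
    have h2 : (n.choose j : ℝ) * (n + 1) = (n + 1).choose j * (n + 1 - j) := by
      rcases le_or_gt j (n + 1) with hle | hgt
      · have := Nat.choose_mul_succ_eq n j
        rw [← Nat.cast_inj (R := ℝ)] at this
        push_cast [Nat.cast_sub hle] at this
        exact this
      · rw [Nat.choose_eq_zero_of_lt hgt, Nat.choose_eq_zero_of_lt (by omega)]; simp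
    set G := ∏ i ∈ Finset.range n, diracCoeff c (s + 1 + i)
    have hf : ((n + 2).factorial : ℝ) = (n + 2) * ((n + 1) * n.factorial) := by
      rw [Nat.factorial_succ, Nat.factorial_succ]; push_cast; ring
    have hf1 : ((n + 1).factorial : ℝ) = (n + 1) * n.factorial := by
      rw [Nat.factorial_succ]; push_cast; ring
    rw [hf, hf1]
    have hn : (n.factorial : ℝ) ≠ 0 := by positivity
    have hn1 : (n + 1 : ℝ) ≠ 0 := by positivity
    have hn2 : (n + 2 : ℝ) ≠ 0 := by positivity
    have h1' : ((n + 2).choose (j + 1) : ℝ) * (j + 1) = (n + 2) * (n + 1).choose j := by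
      push_cast at h1; linarith
    have h2' : (n.choose j : ℝ) = (n + 1).choose j * (n + 1 - j) / (n + 1) := by
      rw [eq_div_iff hn1, h2]
    rw [h2']
    push_cast
    calc _ = ((c + 2 * n + 2) * diracCoeff c s) * (((2 ^ (n + 1) * ((n + 1) * n.factorial) : ℝ))⁻¹ *
          ((-1) ^ (n + 1) * G) * (n + 1).choose j) := by ring
      _ = _ := by
        rw [hb]
        have : ∀ z : ℝ, z * (G * (c + 2 * j) * (2 * (j + 1))) * ((n + 2).choose (j + 1) : ℝ) =
            z * (G * (c + 2 * j) * 2) * ((n + 2) * (n + 1).choose j) := fun z => by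
          rw [← h1']; ring
        rw [this]
        field_simp
        ring
  · rw [coeff_weight_pow_odd _ (s + n) ⟨j, hj⟩, coeff_weight_pow_odd _ (s + n) ⟨j, hj⟩,
      coeff_weight_pow_odd _ (s + (n + 2)) ⟨j + 1, by omega⟩]
    simp

theorem scaledLegendre_zero (c : ℝ) : scaledLegendre c 0 = 1 := by simp [scaledLegendre]

theorem scaledLegendre_one (c : ℝ) : scaledLegendre c 1 = -X := by
  have : radialDirac c 1 = 0 := by
    rw [← monomial_zero_one, radialDirac_monomial]; simp [diracCoeff]
  have h := radialDirac_weight_mul c 1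
  rw [this, mul_one] at h
  have h2 : (2 * X : ℝ[X]) = (2 : ℝ) • X := by rw [two_smul, two_mul]
  simp only [scaledLegendre, Function.iterate_one, pow_one, h, h2]
  simp [smul_smul]

/-! ### The radial moment functional and orthonormality -/

/-- The linear functional `P ↦ ∫₀¹ r^{c-1} Re P(ir) dr`. -/
def moment (c : ℝ) : ℝ[X] →ₗ[ℝ] ℝ :=
  Polynomial.lsum fun s => ((Complex.I ^ s).re / (s + c)) • LinearMap.id

theorem moment_monomial (c : ℝ) (s : ℕ) (r : ℝ) :
    moment c (monomial s r) = (Complex.I ^ s).re / (s + c) * r := by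
  simp [moment, Polynomial.lsum_apply, Polynomial.sum_monomial_index]

/-- The divergence theorem in radial form: the factor `c + 2j` of an odd power cancels the
denominator of the moment, leaving only a boundary value at `r = 1`. -/
theorem moment_radialDirac_monomial {c : ℝ} (hc : 0 < c) (s : ℕ) (r : ℝ) :
    moment c (radialDirac c (monomial s r)) = -(Complex.I ^ s).im * r := by
  rw [radialDirac_monomial, map_smul, moment_monomial, smul_eq_mul]
  rcases Nat.even_or_odd' s with ⟨j, rfl | rfl⟩
  · rcases j with _ | j
    · simp [diracCoeff]
    · rw [show 2 * (j + 1) - 1 = 2 * j + 1 by omega, pow_succ, pow_mul, pow_mul, Complex.I_sq]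
      rcases neg_one_pow_eq_or ℂ j with h | h <;> rcases neg_one_pow_eq_or ℂ (j + 1) with h' | h' <;>
        simp [h, h']
  · rw [show 2 * j + 1 - 1 = 2 * j by omega, pow_succ, pow_mul, Complex.I_sq, diracCoeff_odd]
    have : (c + 2 * j) ≠ 0 := by positivity
    have h2 : (2 * j + c) ≠ 0 := by positivity
    rcases neg_one_pow_eq_or ℂ j with h | h <;> simp [h] <;> field_simp <;> ring

/-- The boundary term vanishes because `1 + X²` is zero at `X = i`. -/
theorem moment_radialDirac_weight_mul {c : ℝ} (hc : 0 < c) (P : ℝ[X]) :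
    moment c (radialDirac c (weight * P)) = 0 := by
  induction P using Polynomial.induction_on' with
  | add p q hp hq => rw [mul_add, map_add, map_add, hp, hq, add_zero]
  | monomial n r =>
    rw [weight, add_mul, one_mul, X_pow_mul_monomial, map_add, map_add,
      moment_radialDirac_monomial hc, moment_radialDirac_monomial hc, pow_add, Complex.I_sq]
    simp

theorem moment_scaledLegendre {c : ℝ} (hc : 0 < c) (n : ℕ) :
    moment c (scaledLegendre c (n + 1)) = 0 := by
  obtain ⟨Q, hQ⟩ := weight_pow_dvd_iterate c n 1
  rw [scaledLegendre, map_smul, Function.iterate_succ_apply', add_comm n 1, hQ, pow_one,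
    moment_radialDirac_weight_mul hc, smul_zero]

/-- The polynomial of the normalised Clifford-Legendre polynomial. -/
def orthoLegendre (c : ℝ) (n : ℕ) : ℝ[X] := Real.sqrt (c + 2 * n) • scaledLegendre c n

/-- The off-diagonal entries of the Jacobi matrix. -/
def jacobiCoeff (c : ℝ) (n : ℕ) : ℝ :=
  bonnetCoeff c n / (Real.sqrt (c + 2 * n) * Real.sqrt (c + 2 * n + 2))

theorem X_mul_orthoLegendre_zero {c : ℝ} (hc : 0 < c) :
    X * orthoLegendre c 0 = -(jacobiCoeff c 0) • orthoLegendre c 1 := by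
  have h1 : 0 < Real.sqrt c := Real.sqrt_pos.2 hc
  have h2 : 0 < Real.sqrt (c + 2) := Real.sqrt_pos.2 (by linarith)
  simp only [orthoLegendre, jacobiCoeff, scaledLegendre_zero, scaledLegendre_one, bonnetCoeff]
  rw [mul_smul_comm, smul_smul, mul_one, smul_neg, ← neg_smul]
  congr 1
  simp only [Nat.cast_zero, mul_zero, add_zero, Nat.cast_one, mul_one, Even.zero, if_true]
  field_simp
  rw [Real.sq_sqrt hc.le]

theorem X_mul_orthoLegendre_succ {c : ℝ} (hc : 0 < c) (n : ℕ) :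
    X * orthoLegendre c (n + 1) = -(jacobiCoeff c (n + 1)) • orthoLegendre c (n + 2) +
      jacobiCoeff c n • orthoLegendre c n := by
  have p0 : 0 < c + 2 * n := by positivity
  have p1 : 0 < c + 2 * n + 2 := by positivity
  have p2 : 0 < c + 2 * n + 2 + 2 := by positivity
  have h0 := Real.sqrt_pos.2 p0
  have h1 := Real.sqrt_pos.2 p1
  have h2 := Real.sqrt_pos.2 p2
  have e1 : c + 2 * ((n + 1 : ℕ) : ℝ) = c + 2 * n + 2 := by push_cast; ring
  have e2 : c + 2 * ((n + 2 : ℕ) : ℝ) = c + 2 * n + 2 + 2 := by push_cast; ring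
  have h := X_mul_scaledLegendre c n
  rw [← eq_inv_smul_iff₀ p1.ne'] at h
  simp only [orthoLegendre, jacobiCoeff, e1, e2]
  rw [mul_smul_comm, h]
  simp only [smul_add, smul_smul]
  have hs := Real.sq_sqrt p1.le
  congr 2
  · field_simp
    rw [hs]
  · field_simp
    rw [hs]

/-- The bilinear form `∫₀¹ r^{c-1} Re (P(-ir) Q(ir)) dr`. -/
def radialForm (c : ℝ) (P Q : ℝ[X]) : ℝ := moment c (P.comp (-X) * Q)

/-- The skewness comes from the substitution `X ↦ -X` in the left argument. -/
theorem radialForm_X_mul (c : ℝ) (P Q : ℝ[X]) :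
    radialForm c (X * P) Q = -radialForm c P (X * Q) := by
  rw [radialForm, radialForm, ← map_neg, mul_comp, X_comp]; congr 1; ring

theorem radialForm_add_left (c : ℝ) (P P' Q : ℝ[X]) :
    radialForm c (P + P') Q = radialForm c P Q + radialForm c P' Q := by
  rw [radialForm, add_comp, add_mul, map_add]; rfl

theorem radialForm_add_right (c : ℝ) (P Q Q' : ℝ[X]) :
    radialForm c P (Q + Q') = radialForm c P Q + radialForm c P Q' := by
  rw [radialForm, mul_add, map_add]; rfl

theorem radialForm_smul_left (c r : ℝ) (P Q : ℝ[X]) :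
    radialForm c (r • P) Q = r * radialForm c P Q := by
  rw [radialForm, smul_comp, smul_mul_assoc, map_smul]; rfl

theorem radialForm_smul_right (c r : ℝ) (P Q : ℝ[X]) :
    radialForm c P (r • Q) = r * radialForm c P Q := by
  rw [radialForm, mul_smul_comm, map_smul]; rfl

theorem jacobiCoeff_ne_zero {c : ℝ} (hc : 0 < c) (n : ℕ) : jacobiCoeff c n ≠ 0 := by
  have h0 := Real.sqrt_pos.2 (show 0 < c + 2 * n by positivity)
  have h1 := Real.sqrt_pos.2 (show 0 < c + 2 * n + 2 by positivity)
  refine div_ne_zero ?_ (mul_pos h0 h1).ne'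
  rw [bonnetCoeff]
  split_ifs <;> positivity

theorem radialForm_zero_orthoLegendre {c : ℝ} (hc : 0 < c) (j : ℕ) :
    radialForm c (orthoLegendre c 0) (orthoLegendre c j) = if 0 = j then 1 else 0 := by
  rw [orthoLegendre, orthoLegendre, radialForm_smul_left, radialForm_smul_right,
    scaledLegendre_zero, radialForm, one_comp, one_mul]
  rcases j with _ | j
  · rw [scaledLegendre_zero, ← monomial_zero_one, moment_monomial]
    have := Real.sq_sqrt hc.le
    simp
    rw [← mul_assoc, ← pow_two, this, mul_inv_cancel₀ hc.ne']
  · rw [moment_scaledLegendre hc]; simp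

/-- If row `i` of the Gram matrix is known, moving `X` to the right argument and applying the
recurrence there gives the pairings of `X` times the `i`-th polynomial. -/
theorem radialForm_X_orthoLegendre {c : ℝ} (hc : 0 < c) {i : ℕ} (hi : ∀ j,
      radialForm c (orthoLegendre c i) (orthoLegendre c j) = if i = j then 1 else 0) (j : ℕ) :
    radialForm c (X * orthoLegendre c i) (orthoLegendre c j) =
      (if i = j + 1 then jacobiCoeff c j else 0) - (if i + 1 = j then jacobiCoeff c i else 0) := by
  rw [radialForm_X_mul]
  rcases j with _ | j
  · rw [X_mul_orthoLegendre_zero hc, radialForm_smul_right, hi]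
    split_ifs <;> simp_all
  · rw [X_mul_orthoLegendre_succ hc, radialForm_add_right, radialForm_smul_right,
      radialForm_smul_right, hi, hi]
    by_cases h1 : i = j + 2
    · subst h1; simp
    · by_cases h2 : i = j
      · subst h2; simp [add_assoc]
      · simp [h1, h2]

/-- Row `0` determines all others: the recurrence expresses each polynomial through `X` times its
predecessor and the one before that, and its leading coefficient is nonzero. Only the diagonal is
used later, but the induction needs whole rows. -/
theorem radialForm_orthoLegendre {c : ℝ} (hc : 0 < c) (i : ℕ) : ∀ j : ℕ,
    radialForm c (orthoLegendre c i) (orthoLegendre c j) = if i = j then 1 else 0 := by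
  induction i using Nat.strong_induction_on with
  | _ i ih =>
  rcases i with _ | _ | i
  · exact radialForm_zero_orthoLegendre hc
  · intro j
    have h := radialForm_X_orthoLegendre hc (ih 0 (by omega)) j
    rw [X_mul_orthoLegendre_zero hc, radialForm_smul_left] at h
    apply mul_left_cancel₀ (neg_ne_zero.2 (jacobiCoeff_ne_zero hc 0))
    simp only [zero_add] at *
    rw [h]
    split_ifs <;> simp_all
  · intro j
    have h := radialForm_X_orthoLegendre hc (ih (i + 1) (by omega)) j
    rw [X_mul_orthoLegendre_succ hc, radialForm_add_left, radialForm_smul_left,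
      radialForm_smul_left, ih i (by omega)] at h
    apply mul_left_cancel₀ (neg_ne_zero.2 (jacobiCoeff_ne_zero hc (i + 1)))
    by_cases h1 : i = j
    · subst h1; simp [add_assoc] at h ⊢; exact h
    · simp [h1] at h ⊢
      rw [show i + 1 + 1 = i + 2 by ring] at *
      rw [h]; split_ifs <;> simp

/-! ### The Dirac operator on `P(x) Y` and the Rodrigues formula -/

instance finiteDimensionalCl (m : ℕ) : FiniteDimensional ℝ (Cl m) :=
  Module.Basis.finiteDimensional_of_finite (bladeBasis m)

/-- Clifford multiplication as a continuous bilinear map. -/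
def mulCLM (m : ℕ) : Cl m →L[ℝ] Cl m →L[ℝ] Cl m :=
  (LinearMap.mul ℝ (Cl m)).toContinuousBilinearMap

theorem mulCLM_apply {m : ℕ} (a b : Cl m) : mulCLM m a b = a * b := rfl

/-- The embedding `vec` as a continuous linear map. -/
def vecCLM (m : ℕ) : E m →L[ℝ] Cl m :=
  LinearMap.toContinuousLinearMap (CliffordAlgebra.ι (negNormSq m))

theorem vecCLM_apply {m : ℕ} (x : E m) : vecCLM m x = vec x := rfl

section Monogenic

variable {m k : ℕ} {Y : E m → Cl m}

theorem IsHomogeneousPolynomial.contDiff (h : IsHomogeneousPolynomial k Y) :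
    ContDiff ℝ 1 Y := by
  obtain ⟨p, -, hp⟩ := h
  rw [show Y = fun x => ∑ A, MvPolynomial.eval (fun j => x j) (p A) • bladeBasis m A from
    funext hp]
  refine ContDiff.sum fun A _ => ContDiff.fun_smul ?_ contDiff_const
  induction p A using MvPolynomial.induction_on with
  | C r => simpa using contDiff_const
  | add p q hp hq => simpa using hp.add hq
  | mul_X p i hp =>
    simp only [map_mul, MvPolynomial.eval_X]
    exact hp.mul (by fun_prop)

theorem IsHomogeneousPolynomial.map_smul (h : IsHomogeneousPolynomial k Y) (r : ℝ) (x : E m) :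
    Y (r • x) = r ^ k • Y x := by
  obtain ⟨p, hk, hp⟩ := h
  rw [hp, hp, Finset.smul_sum]
  refine Finset.sum_congr rfl fun A _ => ?_
  rw [smul_smul]
  congr 1
  rw [MvPolynomial.eval_eq, MvPolynomial.eval_eq, Finset.mul_sum]
  refine Finset.sum_congr rfl fun d hd => ?_
  have hdeg := hk A (MvPolynomial.mem_support_iff.1 hd)
  simp only [PiLp.smul_apply, smul_eq_mul, mul_pow, Finset.prod_mul_distrib,
    Finset.prod_pow_eq_pow_sum]
  rw [← hdeg, Finsupp.weight_apply, Finsupp.sum_fintype _ _ (by simp)]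
  simp only [Pi.one_apply, smul_eq_mul, mul_one]
  have : ∑ i ∈ d.support, d i = ∑ i, d i :=
    Finset.sum_subset (Finset.subset_univ _) fun i _ hi => by simpa using hi
  rw [this]; ring

theorem dirac_eq_fderiv {f : E m → Cl m} {x : E m} (hf : DifferentiableAt ℝ f x) :
    dirac f x = ∑ j, e j * fderiv ℝ f x (stdVec j) := by
  simp only [dirac, hf.lineDeriv_eq_fderiv]

theorem dirac_add {f g : E m → Cl m} {x : E m} (hf : DifferentiableAt ℝ f x)
    (hg : DifferentiableAt ℝ g x) :
    dirac (fun y => f y + g y) x = dirac f x + dirac g x := by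
  rw [dirac_eq_fderiv (hf.fun_add hg), dirac_eq_fderiv hf, dirac_eq_fderiv hg, fderiv_fun_add hf hg,
    ← Finset.sum_add_distrib]
  simp [mul_add]

theorem dirac_const_smul {f : E m → Cl m} {x : E m} (r : ℝ) (hf : DifferentiableAt ℝ f x) :
    dirac (fun y => r • f y) x = r • dirac f x := by
  rw [dirac_eq_fderiv (hf.fun_const_smul r), dirac_eq_fderiv hf, fderiv_fun_const_smul hf,
    Finset.smul_sum]
  simp

theorem sum_stdVec (x : E m) : ∑ j, x j • (stdVec j : E m) = x := by
  simpa [stdVec] using (EuclideanSpace.basisFun (Fin m) ℝ).sum_repr x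

theorem vec_mul_differentiable {f : E m → Cl m} (hf : Differentiable ℝ f) :
    Differentiable ℝ fun y => vec y * f y := fun x =>
  ((mulCLM m).hasFDerivAt_of_bilinear (vecCLM m).hasFDerivAt
    (hf x).hasFDerivAt).differentiableAt

theorem fderiv_vec_mul {f : E m → Cl m} (hf : Differentiable ℝ f) (x v : E m) :
    fderiv ℝ (fun y => vec y * f y) x v = vec v * f x + vec x * fderiv ℝ f x v := by
  have := ((mulCLM m).hasFDerivAt_of_bilinear (vecCLM m).hasFDerivAt
    (hf x).hasFDerivAt).fderiv
  change fderiv ℝ (fun y => mulCLM m (vecCLM m y) (f y)) x v = _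
  rw [this]
  simp [mulCLM_apply, vecCLM_apply, add_comm]

theorem e_mul_vec (j : Fin m) (x : E m) :
    e j * vec x = -(vec x * e j) - (2 * x j) • (1 : Cl m) := by
  have h := CliffordAlgebra.ι_mul_ι_add_swap (Q := negNormSq m) (stdVec j) x
  have h0 : QuadraticMap.polar (negNormSq m) (stdVec j) x = -(2 * x j) := by
    simp [QuadraticMap.polar, negNormSq, stdVec, inner_add_right,
      EuclideanSpace.inner_single_left, EuclideanSpace.inner_single_right]
    ring
  rw [h0, Algebra.algebraMap_eq_smul_one] at h
  rw [e, vec, vec, eq_sub_iff_add_eq, eq_neg_iff_add_eq_zero, add_right_comm, h]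
  simp

/-- Moving `e j` past `x` by `e_j x = -x e_j - 2x_j` produces the Euler operator; the terms `e_j²`
contribute `-m`. -/
theorem dirac_vec_mul {f : E m → Cl m} (hf : Differentiable ℝ f) (x : E m) :
    dirac (fun y => vec y * f y) x =
      -((m : ℝ) • f x) - vec x * dirac f x - (2 : ℝ) • fderiv ℝ f x x := by
  rw [dirac_eq_fderiv (vec_mul_differentiable hf x), dirac_eq_fderiv (hf x)]
  have : ∀ j : Fin m, e j * fderiv ℝ (fun y => vec y * f y) x (stdVec j) =
      -(f x) - vec x * (e j * fderiv ℝ f x (stdVec j)) -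
        (2 : ℝ) • fderiv ℝ f x (x j • stdVec j) := by
    intro j
    rw [fderiv_vec_mul hf, mul_add, ← mul_assoc, ← mul_assoc, ← e, e_mul_self, e_mul_vec, sub_mul,
      neg_mul, neg_mul, one_mul, smul_one_mul, ContinuousLinearMap.map_smul, smul_smul, mul_assoc]
    abel
  simp only [this, Finset.sum_sub_distrib, ← Finset.smul_sum, ← Finset.mul_sum, ← map_sum,
    sum_stdVec]
  simp [← Nat.cast_smul_eq_nsmul ℝ]

theorem fderiv_self_of_homogeneous {f : E m → Cl m} {d : ℕ} {x : E m}
    (hf : DifferentiableAt ℝ f x) (h : ∀ (r : ℝ) (y : E m), f (r • y) = r ^ d • f y) :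
    fderiv ℝ f x x = (d : ℝ) • f x := by
  have h1 : HasDerivAt (fun t : ℝ => f (t • x)) (fderiv ℝ f x x) 1 := by
    have ht : HasDerivAt (fun t : ℝ => t • x) x 1 := by
      simpa using (hasDerivAt_id (1 : ℝ)).smul_const x
    have hf' : HasFDerivAt f (fderiv ℝ f x) ((1 : ℝ) • x) := by
      rw [one_smul]; exact hf.hasFDerivAt
    exact hf'.comp_hasDerivAt (1 : ℝ) ht
  have h2 : HasDerivAt (fun t : ℝ => f (t • x)) ((d : ℝ) • f x) 1 := by
    simp only [h]
    simpa using (hasDerivAt_pow d (1 : ℝ)).smul_const (f x)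
  exact h1.unique h2

/-- The function `x ↦ P(x) Y(x)` for a polynomial `P` in the Clifford variable `x`. -/
def polyMul (Y : E m → Cl m) (P : ℝ[X]) (x : E m) : Cl m := aeval (vec x) P * Y x

theorem polyMul_add (P Q : ℝ[X]) (x : E m) :
    polyMul Y (P + Q) x = polyMul Y P x + polyMul Y Q x := by
  simp [polyMul, add_mul]

theorem polyMul_smul (r : ℝ) (P : ℝ[X]) (x : E m) :
    polyMul Y (r • P) x = r • polyMul Y P x := by
  simp [polyMul]

theorem polyMul_X_mul (P : ℝ[X]) (x : E m) :
    polyMul Y (X * P) x = vec x * polyMul Y P x := by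
  simp [polyMul, mul_assoc]

theorem polyMul_monomial (s : ℕ) (r : ℝ) (x : E m) :
    polyMul Y (monomial s r) x = r • (vec x ^ s * Y x) := by
  simp [polyMul, aeval_monomial, Algebra.algebraMap_eq_smul_one]

theorem aeval_weight (x : E m) :
    aeval (vec x) weight = algebraMap ℝ (Cl m) (1 - ‖x‖ ^ 2) := by
  rw [weight, map_add, map_pow, aeval_X, pow_two, vec_mul_self, map_one, ← map_one (algebraMap ℝ _),
    ← map_add]
  congr 1; ring

theorem polyMul_weight_pow_mul (j : ℕ) (P : ℝ[X]) (x : E m) :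
    polyMul Y (weight ^ j * P) x = (1 - ‖x‖ ^ 2) ^ j • polyMul Y P x := by
  rw [polyMul, polyMul, map_mul, map_pow, aeval_weight, ← map_pow, Algebra.algebraMap_eq_smul_one,
    smul_mul_assoc, smul_mul_assoc, one_mul]

theorem vec_pow_mul_differentiable (hY : Differentiable ℝ Y) (s : ℕ) :
    Differentiable ℝ fun y => vec y ^ s * Y y := by
  induction s with
  | zero => simpa using hY
  | succ s ih => simpa only [pow_succ', mul_assoc] using vec_mul_differentiable ih

theorem polyMul_differentiable (hY : Differentiable ℝ Y) (P : ℝ[X]) :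
    Differentiable ℝ (polyMul Y P) := by
  induction P using Polynomial.induction_on' with
  | add p q hp hq =>
    rw [show polyMul Y (p + q) = fun x => polyMul Y p x + polyMul Y q x from
      funext (polyMul_add p q)]
    exact hp.fun_add hq
  | monomial s r =>
    rw [show polyMul Y (monomial s r) = fun x => r • (vec x ^ s * Y x) from
      funext (polyMul_monomial s r)]
    exact (vec_pow_mul_differentiable hY s).fun_const_smul r

theorem vec_smul (r : ℝ) (x : E m) : vec (r • x) = r • vec x := map_smul _ r x

theorem dirac_vec_pow_mul (hY : Y ∈ sphericalMonogenics m k) (s : ℕ) (x : E m) :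
    dirac (fun y => vec y ^ s * Y y) x =
      -(diracCoeff (2 * k + m) s) • (vec x ^ (s - 1) * Y x) := by
  have hd : Differentiable ℝ Y := hY.1.contDiff.differentiable one_ne_zero
  induction s with
  | zero => simp [diracCoeff, hY.2]
  | succ s ih =>
    simp only [pow_succ', mul_assoc]
    have hds := vec_pow_mul_differentiable hd s
    -- `x^s Y` is homogeneous of degree `s + k`, so Euler's identity yields `m + 2(s + k) = c + 2s`,
    -- the constant in the recursion for `γ`.
    rw [dirac_vec_mul hds, ih, fderiv_self_of_homogeneous (d := s + k) (hds x)]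
    · have : diracCoeff (2 * k + m) s • (vec x * (vec x ^ (s - 1) * Y x)) =
          diracCoeff (2 * k + m) s • (vec x ^ s * Y x) := by
        rcases s with _ | s
        · simp [diracCoeff]
        · simp [pow_succ', mul_assoc]
      rw [neg_smul, mul_neg, mul_smul_comm, this, Nat.add_sub_cancel, diracCoeff]
      push_cast
      module
    · intro r y
      rw [vec_smul, _root_.smul_pow, hY.1.map_smul, smul_mul_smul_comm, pow_add]

theorem dirac_polyMul (hY : Y ∈ sphericalMonogenics m k) (P : ℝ[X]) (x : E m) :
    dirac (polyMul Y P) x = polyMul Y (radialDirac (2 * k + m) P) x := by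
  have hd : Differentiable ℝ Y := hY.1.contDiff.differentiable one_ne_zero
  induction P using Polynomial.induction_on' with
  | add p q hp hq =>
    rw [map_add, polyMul_add, ← hp, ← hq, show polyMul Y (p + q) =
      fun x => polyMul Y p x + polyMul Y q x from funext (polyMul_add p q),
      dirac_add (polyMul_differentiable hd p x) (polyMul_differentiable hd q x)]
  | monomial s r =>
    rw [show polyMul Y (monomial s r) = fun x => r • (vec x ^ s * Y x) from
      funext (polyMul_monomial s r),
      dirac_const_smul r (vec_pow_mul_differentiable hd s x), dirac_vec_pow_mul hY,
      radialDirac_monomial, polyMul_smul, polyMul_monomial, smul_comm]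

/-- The Rodrigues formula. -/
theorem weight_smul_gegenbauer (hY : Y ∈ sphericalMonogenics m k) (n : ℕ) : ∀ (α : ℕ) (x : E m),
    (1 - ‖x‖ ^ 2) ^ α • gegenbauer (α : ℝ) n Y x =
      polyMul Y ((radialDirac (2 * k + m))^[n] (weight ^ (α + n))) x := by
  induction n with
  | zero =>
    intro α x
    rw [gegenbauer, Function.iterate_zero_apply, add_zero, ← mul_one (weight ^ α),
      polyMul_weight_pow_mul]
    simp [polyMul]
  | succ n ih =>
    intro α x
    have h1 : (fun y : E m => (1 - ‖y‖ ^ 2) ^ ((α : ℝ) + 1) • gegenbauer ((α : ℝ) + 1) n Y y) =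
        polyMul Y ((radialDirac (2 * k + m))^[n] (weight ^ (α + 1 + n))) := by
      ext1 y
      rw [← ih (α + 1) y, ← Nat.cast_add_one, Real.rpow_natCast]
    rw [gegenbauer, diffOp, h1, dirac_polyMul hY,
      ← Function.iterate_succ_apply' (radialDirac (2 * (k : ℝ) + m)),
      show α + 1 + n = α + (n + 1) by ring]
    -- On the unit sphere the powers cannot be cancelled; there both sides vanish by divisibility
    -- when `α > 0`, and for `α = 0` the factors are `1`.
    by_cases h0 : (1 - ‖x‖ ^ 2) = 0
    · obtain ⟨Q, hQ⟩ := weight_pow_dvd_iterate (2 * k + m) (n + 1) α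
      rw [hQ, polyMul_weight_pow_mul, h0]
      rcases α with _ | α <;> simp
    · have h2 : (1 - ‖x‖ ^ 2) ^ (-(α : ℝ)) = ((1 - ‖x‖ ^ 2) ^ α)⁻¹ := by
        rw [show -(α : ℝ) = ((-(α : ℤ) : ℤ) : ℝ) by push_cast; rfl, Real.rpow_intCast, zpow_neg,
          zpow_natCast]
      rw [smul_smul, h2, mul_inv_cancel₀ (pow_ne_zero _ h0), one_smul]

end Monogenic

/-! ### The Clifford norm of `P(x) a` -/

section Norm

variable {m : ℕ}

theorem prod_map_e_of_perm {l l' : List (Fin m)} (h : l.Perm l') :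
    (l.map e).prod = (l'.map e).prod ∨ (l.map e).prod = -(l'.map e).prod := by
  induction h with
  | nil => simp
  | cons a _ ih => rcases ih with ih | ih <;> simp [ih]
  | swap a b l =>
    by_cases h : b = a
    · subst h; simp
    · right
      simp only [List.map_cons, List.prod_cons, ← mul_assoc]
      rw [e_mul_e h, neg_mul]
  | trans _ _ ih1 ih2 => rcases ih1 with ih1 | ih1 <;> rcases ih2 with ih2 | ih2 <;> simp [ih1, ih2]

theorem e_mul_bladeBasis (j : Fin m) (A : Finset (Fin m)) :
    e j * bladeBasis m A = bladeBasis m (symmDiff A {j}) ∨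
      e j * bladeBasis m A = -bladeBasis m (symmDiff A {j}) := by
  have key : ∀ B : Finset (Fin m), j ∉ B → (e j * bladeBasis m B = bladeBasis m (insert j B) ∨
      e j * bladeBasis m B = -bladeBasis m (insert j B)) := by
    intro B hB
    rw [bladeBasis_apply, bladeBasis_apply, ← List.prod_cons, ← List.map_cons]
    apply prod_map_e_of_perm
    apply List.perm_of_nodup_nodup_toFinset_eq
    · simpa using hB
    · exact Finset.sort_nodup _ _
    · simp
  by_cases hj : j ∈ A
  · have h1 : symmDiff A {j} = A.erase j := by
      ext i; simp only [Finset.mem_symmDiff, Finset.mem_singleton, Finset.mem_erase]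
      constructor
      · rintro (h | ⟨rfl, h⟩)
        · exact ⟨h.2, h.1⟩
        · exact absurd hj h
      · exact fun h => Or.inl ⟨h.2, h.1⟩
    have h2 := key (A.erase j) (Finset.notMem_erase j A)
    rw [Finset.insert_erase hj] at h2
    rw [h1]
    rcases h2 with h2 | h2
    · right; rw [← h2, ← mul_assoc, e_mul_self]; simp
    · left; rw [← neg_eq_iff_eq_neg] at h2; rw [← h2, mul_neg, ← mul_assoc, e_mul_self]; simp
  · have h1 : symmDiff A {j} = insert j A := by
      ext i; simp only [Finset.mem_symmDiff, Finset.mem_singleton, Finset.mem_insert]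
      constructor
      · rintro (h | h)
        · exact Or.inr h.1
        · exact Or.inl h.1
      · rintro (rfl | h)
        · exact Or.inr ⟨rfl, hj⟩
        · exact Or.inl ⟨h, fun hh => hj (hh ▸ h)⟩
    rw [h1]; exact key A hj

/-- The real inner product on the Clifford algebra that makes the blades orthonormal. -/
def cliffordInner (m : ℕ) : Cl m →ₗ[ℝ] Cl m →ₗ[ℝ] ℝ :=
  (innerₗ (EuclideanSpace ℝ (Finset (Fin m)))).compl₁₂ (coords m) (coords m)

theorem cliffordInner_self (a : Cl m) : cliffordInner m a a = ‖a‖ ^ 2 := by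
  have : ‖a‖ = ‖coords m a‖ := rfl
  rw [this, cliffordInner]
  simp

theorem cliffordInner_bladeBasis (A B : Finset (Fin m)) :
    cliffordInner m (bladeBasis m A) (bladeBasis m B) = if A = B then 1 else 0 := by
  have : ∀ A, coords m (bladeBasis m A) = EuclideanSpace.single A 1 := by
    intro A
    ext C
    simp [coords, Finsupp.single_apply, eq_comm]
  simp [cliffordInner, this, EuclideanSpace.inner_single_left]

theorem cliffordInner_e_mul_bladeBasis (j : Fin m) (A B : Finset (Fin m)) :
    cliffordInner m (e j * bladeBasis m A) (e j * bladeBasis m B) =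
      cliffordInner m (bladeBasis m A) (bladeBasis m B) := by
  by_cases h : A = B
  · subst h
    rcases e_mul_bladeBasis j A with h | h <;> rw [h] <;> simp [cliffordInner_bladeBasis]
  · have h' : symmDiff A {j} ≠ symmDiff B {j} := fun hh => h (symmDiff_left_injective _ hh)
    rcases e_mul_bladeBasis j A with hA | hA <;> rcases e_mul_bladeBasis j B with hB | hB <;>
      rw [hA, hB] <;> simp [cliffordInner_bladeBasis, h, h']

/-- Left multiplication by `e j` permutes the orthonormal blades up to sign. With `e_j² = -1`, this
isometry is also skew. -/
theorem cliffordInner_e_mul (j : Fin m) (a b : Cl m) :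
    cliffordInner m (e j * a) (e j * b) = cliffordInner m a b := by
  have : (cliffordInner m).compl₁₂ (LinearMap.mulLeft ℝ (e j)) (LinearMap.mulLeft ℝ (e j)) =
      cliffordInner m := by
    refine (bladeBasis m).ext fun A => (bladeBasis m).ext fun B => ?_
    simpa using cliffordInner_e_mul_bladeBasis j A B
  simpa using LinearMap.congr_fun₂ this a b

theorem cliffordInner_e_mul_left (j : Fin m) (a b : Cl m) :
    cliffordInner m (e j * a) b = -cliffordInner m a (e j * b) := by
  rw [← cliffordInner_e_mul j (e j * a) b, ← mul_assoc, e_mul_self]; simp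

theorem vec_eq_sum (x : E m) : vec x = ∑ j, x j • (e j : Cl m) := by
  conv_lhs => rw [← sum_stdVec x]
  simp only [vec, e, map_sum, map_smul]

theorem cliffordInner_vec_mul_left (x : E m) (a b : Cl m) :
    cliffordInner m (vec x * a) b = -cliffordInner m a (vec x * b) := by
  rw [vec_eq_sum, Finset.sum_mul, Finset.sum_mul, map_sum, map_sum, LinearMap.sum_apply,
    ← Finset.sum_neg_distrib]
  refine Finset.sum_congr rfl fun j _ => ?_
  simp [cliffordInner_e_mul_left]

theorem cliffordInner_comm (a b : Cl m) : cliffordInner m a b = cliffordInner m b a := by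
  simp [cliffordInner, real_inner_comm]

/-- Since `x` acts skewly, the adjoint of `P(x)` is `P(-x)`. -/
theorem cliffordInner_aeval_left (x : E m) (P : ℝ[X]) : ∀ a b : Cl m,
    cliffordInner m (aeval (vec x) P * a) b =
      cliffordInner m a (aeval (vec x) (P.comp (-X)) * b) := by
  induction P using Polynomial.induction_on with
  | C r => intro a b; simp [Algebra.algebraMap_eq_smul_one]
  | add p q hp hq => intro a b; simp [add_mul, hp, hq]
  | monomial n r ih =>
    intro a b
    rw [pow_succ', mul_left_comm, map_mul (aeval (vec x)), aeval_X, mul_assoc,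
      cliffordInner_vec_mul_left, ih, mul_comp X, X_comp, mul_comm (-X), map_mul (aeval (vec x)), map_neg, aeval_X,
      mul_neg, neg_mul, map_neg, mul_assoc]

/-- In this diagonal pairing `x` behaves like `i|x|`: even powers are the scalars `(-|x|²)^j`, and
odd powers contribute nothing by skewness, just as odd powers of `i|x|` have real part zero. -/
theorem cliffordInner_aeval_self (x : E m) (P : ℝ[X]) (a : Cl m) :
    cliffordInner m a (aeval (vec x) P * a) =
      (aeval ((‖x‖ : ℂ) * Complex.I) P).re * ‖a‖ ^ 2 := by
  induction P using Polynomial.induction_on' with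
  | add p q hp hq => simp [add_mul, hp, hq]
  | monomial s r =>
    rw [aeval_monomial, aeval_monomial, Algebra.algebraMap_eq_smul_one, smul_one_mul,
      smul_mul_assoc, map_smul, smul_eq_mul]
    have h : cliffordInner m a (vec x ^ s * a) =
        (((‖x‖ : ℂ) * Complex.I) ^ s).re * ‖a‖ ^ 2 := by
      rcases Nat.even_or_odd' s with ⟨j, rfl | rfl⟩
      · rw [pow_mul, pow_mul, pow_two, vec_mul_self, mul_pow, Complex.I_sq, ← map_pow,
          Algebra.algebraMap_eq_smul_one, smul_one_mul, map_smul, cliffordInner_self, smul_eq_mul]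
        congr 1
        rw [show (‖x‖ : ℂ) ^ 2 * -1 = ((-‖x‖ ^ 2 : ℝ) : ℂ) by push_cast; ring,
          ← Complex.ofReal_pow, Complex.ofReal_re]
      · have h0 : cliffordInner m a (vec x * a) = 0 := by
          have := cliffordInner_vec_mul_left x a a
          rw [cliffordInner_comm] at this
          linarith
        rw [pow_succ, pow_succ, pow_mul, pow_mul, pow_two, vec_mul_self, mul_pow, Complex.I_sq,
          ← map_pow, Algebra.algebraMap_eq_smul_one, mul_assoc, smul_one_mul, map_smul, h0,
          show (‖x‖ : ℂ) ^ 2 * -1 = ((-‖x‖ ^ 2 : ℝ) : ℂ) by push_cast; ring,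
          ← Complex.ofReal_pow]
        generalize (-‖x‖ ^ 2) ^ j = u
        simp
    rw [h]
    simp [mul_assoc]

theorem norm_sq_aeval_mul (x : E m) (P : ℝ[X]) (a : Cl m) :
    ‖aeval (vec x) P * a‖ ^ 2 =
      (aeval ((‖x‖ : ℂ) * Complex.I) (P.comp (-X) * P)).re * ‖a‖ ^ 2 := by
  rw [← cliffordInner_self, cliffordInner_aeval_left, ← mul_assoc, ← map_mul,
    cliffordInner_aeval_self]

end Norm

/-! ### The moment as an integral, and polar coordinates -/

section Integral

theorem moment_eq_integral {d : ℕ} (P : ℝ[X]) :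
    moment (d + 1 : ℝ) P = ∫ r in (0 : ℝ)..1, r ^ d * (aeval ((r : ℂ) * Complex.I) P).re := by
  induction P using Polynomial.induction_on' with
  | add p q hp hq =>
    have hc : ∀ p : ℝ[X], Continuous fun r : ℝ =>
        r ^ d * (aeval ((r : ℂ) * Complex.I) p).re := fun p => by
      have : Continuous fun z : ℂ => aeval z p := p.continuous_aeval
      fun_prop
    rw [map_add, hp, hq, ← intervalIntegral.integral_add ((hc p).intervalIntegrable _ _)
      ((hc q).intervalIntegrable _ _)]
    congr 1; ext r; simp [mul_add]
  | monomial s c =>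
    have : ∀ r : ℝ, r ^ d * (aeval ((r : ℂ) * Complex.I) (monomial s c)).re =
        r ^ (d + s) * ((Complex.I ^ s).re * c) := by
      intro r
      rw [aeval_monomial, mul_pow, ← Complex.ofReal_pow, pow_add]
      generalize r ^ s = u
      simp
      ring
    simp only [this]
    rw [intervalIntegral.integral_mul_const, integral_pow, moment_monomial]
    simp
    ring

variable {m : ℕ}

/-- Integration over the unit ball in polar coordinates. -/
theorem setIntegral_closedBall_eq_mul {f : E m → ℝ} {d : ℕ} (hm : 1 ≤ m) (g : ℝ → ℝ)
    (hf : ∀ (r : ℝ) (y : E m), f (r • y) = r ^ d * f y) :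
    ∫ x in Metric.closedBall (0 : E m) 1, g ‖x‖ * f x =
      (∫ θ : Metric.sphere (0 : E m) 1, f θ ∂((volume : Measure (E m)).toSphere)) *
        ∫ r in (0 : ℝ)..1, r ^ (m - 1 + d) * g r := by
  have : Nonempty (Fin m) := ⟨⟨0, hm⟩⟩
  set μ : Measure (E m) := volume
  have hdim : Module.finrank ℝ (E m) = m := by simp
  -- The cutoff `r ≤ 1` goes into the radial factor, so that the integrand over the whole space is a
  -- product on the sphere times `(0, ∞)`.
  let h : ℝ → ℝ := fun r => (Set.Iic (1 : ℝ)).indicator (fun r => r ^ d * g r) r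
  let F : E m → ℝ := (Metric.closedBall (0 : E m) 1).indicator fun x => g ‖x‖ * f x
  have hF : ∀ x : ({(0 : E m)}ᶜ : Set (E m)), F x =
      f (homeomorphUnitSphereProd (E m) x).1 * h (homeomorphUnitSphereProd (E m) x).2 := by
    rintro ⟨x, hx⟩
    have hx0 : ‖x‖ ≠ 0 := norm_ne_zero_iff.2 hx
    have h1 : f x = ‖x‖ ^ d * f (‖x‖⁻¹ • x) := by
      rw [← hf, smul_smul, mul_inv_cancel₀ hx0, one_smul]
    have h2 : F x = if ‖x‖ ≤ 1 then g ‖x‖ * f x else 0 := by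
      classical
      simp only [F, Set.indicator_apply, mem_closedBall_zero_iff]
    simp only [homeomorphUnitSphereProd_apply_fst_coe, homeomorphUnitSphereProd_apply_snd_coe, h2,
      h, Set.indicator_apply, Set.mem_Iic]
    split_ifs
    · rw [h1]; ring
    · simp
  calc ∫ x in Metric.closedBall (0 : E m) 1, g ‖x‖ * f x = ∫ x, F x ∂μ :=
        (integral_indicator measurableSet_closedBall).symm
    _ = ∫ x : ({(0 : E m)}ᶜ : Set (E m)), F x ∂(μ.comap (↑)) := by
      rw [integral_subtype_comap (measurableSet_singleton _).compl F, restrict_compl_singleton]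
    _ = ∫ x, f x.1 * h x.2 ∂μ.toSphere.prod (.volumeIoiPow (Module.finrank ℝ (E m) - 1)) := by
      simp only [hF]
      exact μ.measurePreserving_homeomorphUnitSphereProd.integral_comp
        (Homeomorph.measurableEmbedding _)
        (fun x : Metric.sphere (0 : E m) 1 × Set.Ioi (0 : ℝ) => f x.1 * h x.2)
    _ = (∫ θ, f θ ∂μ.toSphere) * ∫ r : Set.Ioi (0 : ℝ), h r
          ∂.volumeIoiPow (Module.finrank ℝ (E m) - 1) :=
      integral_prod_mul (fun θ : Metric.sphere (0 : E m) 1 => f θ)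
        (fun r : Set.Ioi (0 : ℝ) => h r)
    _ = _ := by
      congr 1
      rw [hdim]
      simp only [Measure.volumeIoiPow, ENNReal.ofReal]
      rw [integral_withDensity_eq_integral_smul,
        integral_subtype_comap measurableSet_Ioi fun a ↦ Real.toNNReal (a ^ (m - 1)) • h a,
        setIntegral_congr_fun (g := (Set.Iic (1 : ℝ)).indicator
          fun r => r ^ (m - 1 + d) * g r) measurableSet_Ioi fun x hx ↦ ?_]
      · rw [setIntegral_indicator measurableSet_Iic, Set.Ioi_inter_Iic,
          intervalIntegral.integral_of_le zero_le_one]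
      · simp only [h, NNReal.smul_def, Real.coe_toNNReal _ (pow_nonneg (le_of_lt hx) _),
          Set.indicator_apply, smul_eq_mul]
        split_ifs
        · ring
        · simp
      · exact (measurable_subtype_coe.pow_const _).real_toNNReal

end Integral

/-! ### Transfer to the Clifford-Legendre polynomials -/

section Main

/-- Rationalizes the factor `√D` of a Jacobi coefficient; `D / 2` is the factor `m/2 + 2N + k` (or
that plus `1`) in the stated denominators. -/
theorem div_sqrt_mul_eq {D p q : ℝ} (v : ℝ) (hD : 0 < D) (hp : p = 2 * q) :
    p / (Real.sqrt D * v) = q * Real.sqrt D / (D / 2 * v) := by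
  have h1 := Real.sqrt_pos.2 hD
  have h2 := Real.sq_sqrt hD.le
  generalize Real.sqrt D = u at *
  rw [hp, ← h2]
  field_simp

variable {m k : ℕ} {Y : E m → Cl m}

theorem normalizedLegendre_eq (hY : Y ∈ sphericalMonogenics m k) (n : ℕ) (x : E m) :
    normalizedLegendre k n Y x = polyMul Y (orthoLegendre (2 * k + m) n) x := by
  have h := weight_smul_gegenbauer hY n 0 x
  rw [pow_zero, one_smul, zero_add, Nat.cast_zero] at h
  rw [normalizedLegendre, legendre, h, orthoLegendre, polyMul_smul, scaledLegendre, polyMul_smul,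
    smul_smul, div_eq_mul_inv]
  congr 3
  ring

theorem vec_mul_normalizedLegendre_zero (hY : Y ∈ sphericalMonogenics m k) (hm : 1 ≤ m)
    (x : E m) : vec x * normalizedLegendre k 0 Y x =
      -(jacobiCoeff (2 * k + m) 0) • normalizedLegendre k 1 Y x := by
  have hc : (0 : ℝ) < 2 * k + m := by positivity
  simp only [normalizedLegendre_eq hY]
  rw [← polyMul_X_mul, X_mul_orthoLegendre_zero hc, polyMul_smul]

theorem vec_mul_normalizedLegendre_succ (hY : Y ∈ sphericalMonogenics m k) (hm : 1 ≤ m)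
    (n : ℕ) (x : E m) : vec x * normalizedLegendre k (n + 1) Y x =
      -(jacobiCoeff (2 * k + m) (n + 1)) • normalizedLegendre k (n + 2) Y x +
        jacobiCoeff (2 * k + m) n • normalizedLegendre k n Y x := by
  have hc : (0 : ℝ) < 2 * k + m := by positivity
  simp only [normalizedLegendre_eq hY]
  rw [← polyMul_X_mul, X_mul_orthoLegendre_succ hc, polyMul_add, polyMul_smul, polyMul_smul]

theorem integral_norm_sq_normalizedLegendre (hY : Y ∈ sphericalMonogenics m k) (hm : 1 ≤ m)
    (n : ℕ) : ∫ x in Metric.closedBall (0 : E m) 1, ‖normalizedLegendre k n Y x‖ ^ 2 =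
      ∫ θ : Metric.sphere (0 : E m) 1, ‖Y θ‖ ^ 2 ∂((volume : Measure (E m)).toSphere) := by
  have hc : (0 : ℝ) < 2 * k + m := by positivity
  have hd : (2 * k + m : ℝ) = ((m - 1 + 2 * k : ℕ) : ℝ) + 1 := by
    rw [Nat.cast_add, Nat.cast_sub hm]; push_cast; ring
  simp only [normalizedLegendre_eq hY, polyMul, norm_sq_aeval_mul]
  set P := orthoLegendre (2 * k + m) n with hP
  -- `|Y|²` has degree `2k`, so the radial weight is `r^(m-1+2k) = r^(c-1)`, exactly that of
  -- `radialForm`.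
  rw [setIntegral_closedBall_eq_mul (f := fun x => ‖Y x‖ ^ 2) (d := 2 * k) hm
    (fun r => (aeval ((r : ℂ) * Complex.I) (P.comp (-X) * P)).re), ← moment_eq_integral, ← hd]
  · have := radialForm_orthoLegendre hc n n
    rw [radialForm, if_pos rfl] at this
    rw [this, mul_one]
  · intro r y
    rw [hY.1.map_smul, norm_smul, mul_pow, norm_pow, ← pow_mul, mul_comm k 2, pow_mul,
      Real.norm_eq_abs, sq_abs, ← pow_mul]

end Main

end CliffordLegendre

end

theorem mainTheorem2 (m : ℕ) (hm : 1 ≤ m) (k : ℕ)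
    (Y : CliffordLegendre.E m → CliffordLegendre.Cl m)
    (hY : Y ∈ CliffordLegendre.sphericalMonogenics m k) :
    -- the polynomials are `L²(B(1))`-normalised when `Y` is `L²(S^{m-1})`-normalised
    ((∫ θ : Metric.sphere (0 : CliffordLegendre.E m) 1, ‖Y θ‖ ^ 2
          ∂((volume : Measure (CliffordLegendre.E m)).toSphere) = 1) →
        ∀ n : ℕ, ∫ x in Metric.closedBall (0 : CliffordLegendre.E m) 1,
          ‖CliffordLegendre.normalizedLegendre k n Y x‖ ^ 2 = 1) ∧
    -- even index, `N = 0`: the second term is absent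
    (∀ x : CliffordLegendre.E m,
      CliffordLegendre.vec x * CliffordLegendre.normalizedLegendre k 0 Y x =
        (-((m / 2 + k : ℝ) * Real.sqrt (m + 2 * k)) /
            ((m / 2 + k) * Real.sqrt (m + 2 * k + 2))) •
          CliffordLegendre.normalizedLegendre k 1 Y x) ∧
    -- even index, `N ≥ 1`
    (∀ N : ℕ, 1 ≤ N → ∀ x : CliffordLegendre.E m,
      CliffordLegendre.vec x * CliffordLegendre.normalizedLegendre k (2 * N) Y x =
        (-((m / 2 + N + k : ℝ) * Real.sqrt (m + 4 * N + 2 * k)) /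
            ((m / 2 + 2 * N + k) * Real.sqrt (m + 4 * N + 2 * k + 2))) •
          CliffordLegendre.normalizedLegendre k (2 * N + 1) Y x +
        ((N * Real.sqrt (m + 4 * N + 2 * k) : ℝ) /
            ((m / 2 + 2 * N + k) * Real.sqrt (m + 4 * N + 2 * k - 2))) •
          CliffordLegendre.normalizedLegendre k (2 * N - 1) Y x) ∧
    -- odd index
    (∀ N : ℕ, ∀ x : CliffordLegendre.E m,
      CliffordLegendre.vec x * CliffordLegendre.normalizedLegendre k (2 * N + 1) Y x =
        (-((N + 1 : ℝ) * Real.sqrt (m + 4 * N + 2 * k + 2)) /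
            ((m / 2 + 2 * N + k + 1) * Real.sqrt (m + 4 * N + 2 * k + 4))) •
          CliffordLegendre.normalizedLegendre k (2 * N + 2) Y x +
        (((m / 2 + N + k : ℝ) * Real.sqrt (m + 4 * N + 2 * k + 2)) /
            ((m / 2 + 2 * N + k + 1) * Real.sqrt (m + 4 * N + 2 * k))) •
          CliffordLegendre.normalizedLegendre k (2 * N) Y x) := by
  refine ⟨fun h n => ?_, fun x => ?_, fun N hN x => ?_, fun N x => ?_⟩
  · rw [CliffordLegendre.integral_norm_sq_normalizedLegendre hY hm, h]
  · rw [CliffordLegendre.vec_mul_normalizedLegendre_zero hY hm]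
    congr 2
    have h0 : (0 : ℝ) < m + 2 * k := by positivity
    have e1 : (m / 2 + k : ℝ) = (m + 2 * k) / 2 := by ring
    simp only [CliffordLegendre.jacobiCoeff, CliffordLegendre.bonnetCoeff, Even.zero, if_true,
      Nat.cast_zero, mul_zero, add_zero]
    rw [add_comm (2 * k : ℝ), e1, neg_div]
    exact congrArg _ (CliffordLegendre.div_sqrt_mul_eq _ h0 (by ring))
  · obtain ⟨M, rfl⟩ : ∃ M, N = M + 1 := ⟨N - 1, by omega⟩
    have h := CliffordLegendre.vec_mul_normalizedLegendre_succ hY hm (2 * M + 1) x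
    rw [show 2 * M + 1 + 1 = 2 * (M + 1) by ring, show 2 * M + 1 + 2 = 2 * (M + 1) + 1 by ring] at h
    rw [h, show 2 * (M + 1) - 1 = 2 * M + 1 by omega]
    have h0 : (0 : ℝ) < m + 4 * (M + 1) + 2 * k := by positivity
    have e1 : (m / 2 + 2 * (M + 1) + k : ℝ) = (m + 4 * (M + 1) + 2 * k) / 2 := by ring
    have n1 : ¬ Even (2 * M + 1) := by simp
    simp only [CliffordLegendre.jacobiCoeff, CliffordLegendre.bonnetCoeff, if_neg n1,
      if_pos (even_two_mul (M + 1))]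
    push_cast
    rw [e1, show (2 * k + m + 2 * (2 * (M + 1)) : ℝ) = m + 4 * (M + 1) + 2 * k by ring,
      show (2 * k + m + 2 * (2 * M + 1) : ℝ) = m + 4 * (M + 1) + 2 * k - 2 by ring,
      sub_add_cancel]
    congr 2
    · rw [neg_div]
      exact congrArg _ (CliffordLegendre.div_sqrt_mul_eq _ h0 (by ring))
    -- In the lower coefficient the root to be rationalized is the second factor of the denominator.
    · rw [mul_comm (Real.sqrt _)]
      exact CliffordLegendre.div_sqrt_mul_eq _ h0 (by ring)
  · rw [CliffordLegendre.vec_mul_normalizedLegendre_succ hY hm (2 * N) x]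
    have h0 : (0 : ℝ) < m + 4 * N + 2 * k + 2 := by positivity
    have e1 : (m / 2 + 2 * N + k + 1 : ℝ) = (m + 4 * N + 2 * k + 2) / 2 := by ring
    have n1 : ¬ Even (2 * N + 1) := by simp
    simp only [CliffordLegendre.jacobiCoeff, CliffordLegendre.bonnetCoeff, if_neg n1,
      if_pos (even_two_mul N)]
    push_cast
    rw [e1, show (2 * k + m + 2 * (2 * N) : ℝ) = m + 4 * N + 2 * k by ring,
      show (2 * k + m + 2 * (2 * N + 1) : ℝ) = m + 4 * N + 2 * k + 2 by ring,
      show (m + 4 * N + 2 * k + 2 + 2 : ℝ) = m + 4 * N + 2 * k + 4 by ring]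
    congr 2
    · rw [neg_div]
      exact congrArg _ (CliffordLegendre.div_sqrt_mul_eq _ h0 (by ring))
    · rw [mul_comm (Real.sqrt _)]
      exact CliffordLegendre.div_sqrt_mul_eq _ h0 (by ring)
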